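/- Let $R$ be a commutative ring and let $A$ be an $R$-algebra that is a unique factorization domain (every UFD arises in this way, e.g. with $R=\mathbb{Z}$ or $R=A$). Then there exist a principal ideal domain $B$ that is an $R$-algebra and an injective $R$-algebra homomorphism $\varphi\colon A\to B$ such that the subalgebra $\varphi(A)\cong A$ is factorially closed in $B$; that is, for all $a,b\in B\setminus\{0\}$, if $ab\in\varphi(A)$, then $a\in\varphi(A)$ and $b\in\varphi(A)$. -/

import Mathlib

universe u v

/-- A subalgebra `A` of an `R`-algebra `B` is factorially closed (fc) in `B` if, for all nonzero
`a, b` in `B`, the condition `a * b ∈ A` implies `a ∈ A` and `b ∈ A`. -/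
def Subalgebra.IsFactoriallyClosed {R B : Type*} [CommRing R] [CommRing B] [Algebra R B]
    (A : Subalgebra R B) : Prop :=
  ∀ a b : B, a ≠ 0 → b ≠ 0 → a * b ∈ A → a ∈ A ∧ b ∈ A

/-!
The basic step: given relatively prime nonzero elements `a`, `b` of a UFD `C`, the ring
`D = C[x, y] / (a x + b y - 1)` makes `a` and `b` comaximal. It is covered by its localizations
`D[1/b] = C[1/b][x]` and `D[1/a] = C[1/a][y]`, which are polynomial rings. Hence

* `C` is factorially closed in `D`: a factor of a nonzero constant has degree `0` in both charts,
  so it lies in `C[1/a] ∩ C[1/b] = C`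
  (`IsBezoutAdjunction.exists_algebraMap_eq_of_mul_eq`);
* primes of `C` stay prime in `D` (`IsBezoutAdjunction.prime_algebraMap`);
* `D` is a UFD by Kaplansky's criterion (`IsBezoutAdjunction.uniqueFactorizationMonoid`): a prime
  ideal meeting `C` trivially contains a prime `q` of `C[x]`, and dividing `q` by the prime factors
  of `b` as often as possible leaves a prime of `D`.

A directed union of UFDs, each factorially closed in the larger ones, is again a UFD in which all of
them are factorially closed (`Subalgebra.uniqueFactorizationMonoid_iSup_of_directed`), so the basic
step can be iterated by Zorn's lemma. All rings are taken inside one field `Ω`, the fraction field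
of a polynomial ring over `A` with variables `X t`, `t : T`. Cardinal arithmetic provides such a `T`
with a surjection `e : T → Ω × Ω`, so that every pair of elements of `Ω` has its own variable. The
Zorn order is on pairs `(C, J)` where `J ⊆ T` is the set of variables already spent: `C` is
algebraic over `A[X t : t ∈ J]`, and for `t ∈ J` the equation `(e t).1 * x + (e t).2 * y = 1` has a
solution in `C`. If `(C, J)` is maximal and `a`, `b` are relatively prime and nonzero in `C`, the
variable of `(a, b)` must lie in `J`, since otherwise it is transcendental over `C` and the basic
step enlarges `C`. So relatively prime elements of a maximal `C` are comaximal, and a UFD with this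
property is a Bézout domain, hence a PID.
-/

/-! ### The ring obtained by adjoining a Bézout relation -/

/-- `IsBezoutAdjunction a b x y` says that the `C`-algebra `D` behaves like
`C[x, y] / (a x + b y - 1)` for relatively prime nonzero `a` and `b`: the Bézout relation holds,
`x` and `y` are transcendental, and `D` becomes `C[x]`, respectively `C[y]`, up to denominators that
are powers of `b`, respectively `a`. The formulation is symmetric under exchanging `(a, x)` and
`(b, y)`, and no presentation of `D` is fixed. -/
structure IsBezoutAdjunction {C D : Type*} [CommRing C] [CommRing D] [Algebra C D]
    (a b : C) (x y : D) : Prop where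
  left_ne_zero : a ≠ 0
  right_ne_zero : b ≠ 0
  isRelPrime : IsRelPrime a b
  bezout : algebraMap C D a * x + algebraMap C D b * y = 1
  transcendental_left : Transcendental C x
  transcendental_right : Transcendental C y
  exists_left_pow_mul : ∀ f : D, ∃ (n : ℕ) (F : Polynomial C),
    algebraMap C D a ^ n * f = Polynomial.aeval y F
  exists_right_pow_mul : ∀ f : D, ∃ (n : ℕ) (F : Polynomial C),
    algebraMap C D b ^ n * f = Polynomial.aeval x F

namespace IsBezoutAdjunction

open Polynomial

variable {C D : Type*} [CommRing C] [CommRing D] [Algebra C D] {a b : C} {x y : D}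

theorem symm (h : IsBezoutAdjunction a b x y) : IsBezoutAdjunction b a y x where
  left_ne_zero := h.right_ne_zero
  right_ne_zero := h.left_ne_zero
  isRelPrime := h.isRelPrime.symm
  bezout := by rw [add_comm]; exact h.bezout
  transcendental_left := h.transcendental_right
  transcendental_right := h.transcendental_left
  exists_left_pow_mul := h.exists_right_pow_mul
  exists_right_pow_mul := h.exists_left_pow_mul

theorem aeval_injective (h : IsBezoutAdjunction a b x y) :
    Function.Injective (aeval x : C[X] →ₐ[C] D) :=
  transcendental_iff_injective.1 h.transcendental_left

theorem algebraMap_injective (h : IsBezoutAdjunction a b x y) :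
    Function.Injective (algebraMap C D) := fun c d hcd =>
  C_injective (h.aeval_injective (by simpa using hcd))

theorem algebraMap_ne_zero (h : IsBezoutAdjunction a b x y) {c : C} (hc : c ≠ 0) :
    algebraMap C D c ≠ 0 :=
  (map_ne_zero_iff _ h.algebraMap_injective).2 hc

theorem isCoprime_pow (h : IsBezoutAdjunction a b x y) (m n : ℕ) :
    IsCoprime (algebraMap C D a ^ m) (algebraMap C D b ^ n) :=
  IsCoprime.pow ⟨x, y, by rw [← h.bezout]; ring⟩

theorem dvd_of_dvd_pow_mul (h : IsBezoutAdjunction a b x y) {p f : D} {m n : ℕ}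
    (h₁ : p ∣ algebraMap C D a ^ m * f) (h₂ : p ∣ algebraMap C D b ^ n * f) : p ∣ f := by
  obtain ⟨u, v, huv⟩ := h.isCoprime_pow m n
  have : f = u * (algebraMap C D a ^ m * f) + v * (algebraMap C D b ^ n * f) := by
    linear_combination -f * huv
  rw [this]
  exact dvd_add (h₁.mul_left _) (h₂.mul_left _)

/-- The localization `D[1/b]` is a polynomial ring over `C[1/b]`, so a prime `p ∤ b` of `C` stays
prime there; the statement is this primality with denominators cleared. -/
theorem exists_dvd_right_pow_mul (h : IsBezoutAdjunction a b x y) {p : C} (hp : Prime p)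
    (hpb : ¬ p ∣ b) {f g : D} (hfg : algebraMap C D p ∣ f * g) :
    ∃ n : ℕ, algebraMap C D p ∣ algebraMap C D b ^ n * f ∨
      algebraMap C D p ∣ algebraMap C D b ^ n * g := by
  obtain ⟨k, hk⟩ := hfg
  obtain ⟨n, F, hF⟩ := h.exists_right_pow_mul f
  obtain ⟨m, G, hG⟩ := h.exists_right_pow_mul g
  obtain ⟨l, K, hK⟩ := h.exists_right_pow_mul k
  have key : Polynomial.C b ^ l * (F * G) = Polynomial.C p * (Polynomial.C b ^ (n + m) * K) := by
    apply h.aeval_injective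
    simp only [map_mul, map_pow, ← hF, ← hG, ← hK, aeval_C]
    linear_combination algebraMap C D b ^ (l + n + m) * hk
  have hpC : Prime (Polynomial.C p) := prime_C_iff.2 hp
  have hmap : ∀ {Q : C[X]}, Polynomial.C p ∣ Q → algebraMap C D p ∣ aeval x Q := by
    rintro _ ⟨Q, rfl⟩
    simp
  rcases hpC.dvd_or_dvd ⟨_, key⟩ with h1 | h1
  · exact absurd (by simpa using map_dvd constantCoeff (hpC.dvd_of_dvd_pow h1)) hpb
  rcases hpC.dvd_or_dvd h1 with h2 | h2
  · exact ⟨n, Or.inl (hF ▸ hmap h2)⟩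
  · exact ⟨m, Or.inr (hG ▸ hmap h2)⟩

/-- Divisibility by `p ∤ a` may be checked after multiplication by a power of `a`. As powers of `a`
and `b` generate the unit ideal of `D`, it suffices to get divisibility after multiplication by a
power of `b` as well; this is clear if `p ∣ b`, and otherwise comes from `C[x]`. -/
theorem dvd_of_dvd_left_pow_mul (h : IsBezoutAdjunction a b x y) {p : C} (hp : Prime p)
    {f : D} {m : ℕ} (hpf : algebraMap C D p ∣ algebraMap C D a ^ m * f) (hpa : ¬ p ∣ a) :
    algebraMap C D p ∣ f := by
  suffices ∃ n : ℕ, algebraMap C D p ∣ algebraMap C D b ^ n * f from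
    h.dvd_of_dvd_pow_mul hpf this.choose_spec
  by_cases hpb : p ∣ b
  · exact ⟨1, by simpa using (map_dvd (algebraMap C D) hpb).mul_right f⟩
  · obtain ⟨n, h1 | h1⟩ := h.exists_dvd_right_pow_mul hp hpb hpf
    -- Then `p` would divide a constant `b ^ i * a ^ m` in `C[x]`.
    · obtain ⟨g, hg⟩ := h1
      obtain ⟨k, G, hG⟩ := h.exists_right_pow_mul g
      have key : Polynomial.C (b ^ (k + n) * a ^ m) = Polynomial.C p * G := by
        apply h.aeval_injective
        simp only [map_mul, map_pow, ← hG, aeval_C]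
        linear_combination algebraMap C D b ^ k * hg
      have hdvd : p ∣ b ^ (k + n) * a ^ m := by
        simpa only [constantCoeff_apply, coeff_C_zero] using map_dvd constantCoeff ⟨G, key⟩
      rcases hp.dvd_or_dvd hdvd with h2 | h2
      · exact absurd (hp.dvd_of_dvd_pow h2) hpb
      · exact absurd (hp.dvd_of_dvd_pow h2) hpa
    · exact ⟨n, h1⟩

variable [IsDomain C]

/-- A factor of a nonzero constant becomes a constant after multiplication by a power of `b`,
by comparing degrees in `C[x]`. -/
theorem exists_right_pow_mul_eq_algebraMap (h : IsBezoutAdjunction a b x y) {f g : D} {c : C}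
    (hc : c ≠ 0) (hfg : f * g = algebraMap C D c) :
    ∃ (n : ℕ) (d : C), algebraMap C D b ^ n * f = algebraMap C D d := by
  obtain ⟨n, F, hF⟩ := h.exists_right_pow_mul f
  obtain ⟨m, G, hG⟩ := h.exists_right_pow_mul g
  have hFG : F * G = Polynomial.C (b ^ (n + m) * c) := by
    apply h.aeval_injective
    rw [map_mul, ← hF, ← hG, aeval_C, map_mul, map_pow, ← hfg]
    ring
  have hne : F * G ≠ 0 := by
    rw [hFG, Ne, C_eq_zero]
    exact mul_ne_zero (pow_ne_zero _ h.right_ne_zero) hc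
  have hdeg : F.natDegree = 0 := by
    have := natDegree_mul (left_ne_zero_of_mul hne) (right_ne_zero_of_mul hne)
    rw [hFG, natDegree_C] at this
    omega
  refine ⟨n, F.coeff 0, ?_⟩
  rw [hF, ← aeval_C x, ← eq_C_of_natDegree_eq_zero hdeg]

/-- `C` is factorially closed in `D`: a factor of a nonzero constant lies in
`C[1/a] ∩ C[1/b] = C`. -/
theorem exists_algebraMap_eq_of_mul_eq [UniqueFactorizationMonoid C] [IsDomain D]
    (h : IsBezoutAdjunction a b x y) {f g : D} {c : C} (hc : c ≠ 0)
    (hfg : f * g = algebraMap C D c) : ∃ d : C, algebraMap C D d = f := by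
  obtain ⟨n, d, hd⟩ := h.exists_right_pow_mul_eq_algebraMap hc hfg
  obtain ⟨m, e, he⟩ := h.symm.exists_right_pow_mul_eq_algebraMap hc hfg
  have key : a ^ m * d = b ^ n * e := by
    apply h.algebraMap_injective
    rw [map_mul, map_mul, ← hd, ← he, map_pow, map_pow]
    ring
  obtain ⟨t, rfl⟩ : b ^ n ∣ d :=
    (h.isRelPrime.symm.pow).dvd_of_dvd_mul_left ⟨e, key⟩
  refine ⟨t, ?_⟩
  have hb : algebraMap C D b ^ n ≠ 0 := pow_ne_zero _ fun h0 => h.right_ne_zero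
    (h.algebraMap_injective (by rw [h0, map_zero]))
  apply mul_left_cancel₀ hb
  rw [hd, map_mul, map_pow]

variable [UniqueFactorizationMonoid C] [IsDomain D]

theorem not_isUnit_algebraMap (h : IsBezoutAdjunction a b x y) {c : C} (hc : ¬ IsUnit c) :
    ¬ IsUnit (algebraMap C D c) := by
  intro hu
  obtain ⟨u, hu⟩ := isUnit_iff_exists_inv.1 hu
  obtain ⟨d, rfl⟩ := h.exists_algebraMap_eq_of_mul_eq one_ne_zero
    (show u * algebraMap C D c = algebraMap C D 1 by rw [mul_comm, hu, map_one])
  exact hc (isUnit_iff_exists_inv.2 ⟨d, h.algebraMap_injective (by rw [map_mul, hu, map_one])⟩)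

theorem prime_algebraMap_of_not_dvd (h : IsBezoutAdjunction a b x y) {p : C} (hp : Prime p)
    (hpa : ¬ p ∣ a) : Prime (algebraMap C D p) := by
  refine ⟨h.algebraMap_ne_zero hp.ne_zero, h.not_isUnit_algebraMap hp.not_isUnit, fun f g hfg => ?_⟩
  obtain ⟨n, h1 | h1⟩ := h.symm.exists_dvd_right_pow_mul hp hpa hfg
  · exact Or.inl (h.dvd_of_dvd_left_pow_mul hp h1 hpa)
  · exact Or.inr (h.dvd_of_dvd_left_pow_mul hp h1 hpa)

theorem prime_algebraMap (h : IsBezoutAdjunction a b x y) {p : C} (hp : Prime p) :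
    Prime (algebraMap C D p) := by
  by_cases hpa : p ∣ a
  · exact h.symm.prime_algebraMap_of_not_dvd hp fun hpb => hp.not_isUnit (h.isRelPrime hpa hpb)
  · exact h.prime_algebraMap_of_not_dvd hp hpa

/-- Multiplicities of `p ∤ a` in `D` are bounded by those in the UFD `C[y]`. -/
theorem finiteMultiplicity_algebraMap (h : IsBezoutAdjunction a b x y) {p : C} (hp : Prime p)
    (hpa : ¬ p ∣ a) {f : D} (hf : f ≠ 0) : FiniteMultiplicity (algebraMap C D p) f := by
  obtain ⟨m, F, hF⟩ := h.exists_left_pow_mul f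
  have hpC : Prime (Polynomial.C p) := prime_C_iff.2 hp
  have hF0 : F ≠ 0 := by
    rintro rfl
    rw [map_zero] at hF
    exact mul_ne_zero (pow_ne_zero _ (h.algebraMap_ne_zero h.left_ne_zero)) hf hF
  obtain ⟨n, hn⟩ := FiniteMultiplicity.of_prime_left hpC hF0
  refine ⟨n, fun ⟨g, hg⟩ => hn ?_⟩
  obtain ⟨k, G, hG⟩ := h.exists_left_pow_mul g
  have key : Polynomial.C a ^ k * F = Polynomial.C p ^ (n + 1) * (Polynomial.C a ^ m * G) := by
    apply h.symm.aeval_injective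
    simp only [map_mul, map_pow, ← hF, ← hG, aeval_C]
    rw [hg]
    ring
  refine hpC.pow_dvd_of_dvd_mul_left _ (fun h1 => hpa ?_) ⟨_, key⟩
  simpa using map_dvd constantCoeff (hpC.dvd_of_dvd_pow h1)

/-- If `d` is relatively prime to `a`, all prime factors of `d` can be divided out of a nonzero
element of `D`. -/
theorem exists_eq_mul_and_forall_prime_not_dvd (h : IsBezoutAdjunction a b x y) {d : C}
    (hd : d ≠ 0) (had : IsRelPrime a d) {f : D} (hf : f ≠ 0) :
    ∃ (s : C) (g : D), f = algebraMap C D s * g ∧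
      ∀ p : C, Prime p → p ∣ d → ¬ algebraMap C D p ∣ g := by
  induction d using UniqueFactorizationMonoid.induction_on_prime with
  | h₁ => exact absurd rfl hd
  | h₂ u hu =>
    exact ⟨1, f, by simp, fun p hp hpu => absurd (isUnit_of_dvd_unit hpu hu) hp.not_isUnit⟩
  | h₃ d q hd0 hq ih =>
    obtain ⟨s, g, rfl, hg⟩ := ih hd0 (had.of_mul_right_right)
    have hqa : ¬ q ∣ a := fun hqa => hq.not_isUnit (had hqa (dvd_mul_right q d))
    obtain ⟨g', hg', hqg'⟩ := (h.finiteMultiplicity_algebraMap hq hqa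
      (right_ne_zero_of_mul hf)).exists_eq_pow_mul_and_not_dvd
    refine ⟨s * q ^ multiplicity (algebraMap C D q) g, g', ?_, fun p hp hpd hpg => ?_⟩
    · conv_lhs => rw [hg']
      rw [map_mul, map_pow, mul_assoc]
    · rcases hp.dvd_or_dvd hpd with h1 | h1
      · exact hqg' ((map_dvd (algebraMap C D) ((hp.associated_of_dvd hq h1).symm.dvd)).trans hpg)
      · exact hg p hp h1 (hg' ▸ hpg.mul_left _)

theorem dvd_of_dvd_algebraMap_mul (h : IsBezoutAdjunction a b x y) {d : C} (hd : d ≠ 0) {q g : D}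
    (hq : ∀ p : C, Prime p → p ∣ d → ¬ algebraMap C D p ∣ q)
    (hdvd : q ∣ algebraMap C D d * g) : q ∣ g := by
  induction d using UniqueFactorizationMonoid.induction_on_prime with
  | h₁ => exact absurd rfl hd
  | h₂ u hu => exact ((hu.map (algebraMap C D)).dvd_mul_left).1 hdvd
  | h₃ d p hd0 hp ih =>
    refine ih hd0 (fun p' hp' hd' => hq p' hp' (hd'.mul_left p)) ?_
    obtain ⟨r, hr⟩ := hdvd
    have hp' := h.prime_algebraMap hp
    rcases hp'.dvd_or_dvd (show algebraMap C D p ∣ q * r from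
      ⟨algebraMap C D d * g, by rw [← hr, map_mul, mul_assoc]⟩) with h1 | ⟨r', rfl⟩
    · exact absurd h1 (hq p hp (dvd_mul_right p d))
    · refine ⟨r', mul_left_cancel₀ hp'.ne_zero ?_⟩
      rw [map_mul] at hr
      linear_combination hr

/-- The proof verifies Kaplansky's criterion that every nonzero prime ideal contains a prime
element. -/
theorem uniqueFactorizationMonoid (h : IsBezoutAdjunction a b x y) :
    UniqueFactorizationMonoid D := by
  refine UniqueFactorizationMonoid.iff_exists_prime_mem_of_isPrime.2 fun P hP0 hP => ?_
  by_cases hPC : P.comap (algebraMap C D) = ⊥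
  swap
  · obtain ⟨p, hpP, hp⟩ := (hP.comap (algebraMap C D)).exists_mem_prime_of_ne_bot hPC
    exact ⟨_, hpP, h.prime_algebraMap hp⟩
  have hconst : ∀ c : C, algebraMap C D c ∈ P → c = 0 := fun c hc => by
    simpa [hPC] using (Ideal.mem_comap (f := algebraMap C D)).2 hc
  -- A prime of `C[x]` in the contraction of `P`; it is not constant by `hconst`.
  obtain ⟨q, hqP, hq⟩ : ∃ q : C[X], aeval x q ∈ P ∧ Prime q := by
    obtain ⟨f, hfP, hf⟩ := P.ne_bot_iff.1 hP0
    obtain ⟨n, F, hF⟩ := h.exists_right_pow_mul f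
    refine (hP.comap (aeval x : C[X] →ₐ[C] D)).exists_mem_prime_of_ne_bot
      ((Submodule.ne_bot_iff _).2 ⟨F, ?_, ?_⟩)
    · rw [Ideal.mem_comap, ← hF]
      exact P.mul_mem_left _ hfP
    · rintro rfl
      rw [map_zero] at hF
      exact mul_ne_zero (pow_ne_zero _ (h.algebraMap_ne_zero h.right_ne_zero)) hf hF
  have hq0 : aeval x q ≠ 0 := (map_ne_zero_iff _ h.aeval_injective).2 hq.ne_zero
  obtain ⟨s, g, hsg, hg⟩ :=
    h.exists_eq_mul_and_forall_prime_not_dvd h.right_ne_zero h.isRelPrime hq0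
  have hs0 : s ≠ 0 := by
    rintro rfl
    exact hq0 (by rw [hsg, map_zero, zero_mul])
  have hgP : g ∈ P := (hP.mem_or_mem (hsg ▸ hqP)).resolve_left fun hs => hs0 (hconst s hs)
  refine ⟨g, hgP, right_ne_zero_of_mul (hsg ▸ hq0),
    fun hu => hP.ne_top (Ideal.eq_top_of_isUnit_mem _ hgP hu), ?_⟩
  -- Here `q` and `g` differ by a constant factor, and `g` is divisible by no prime factor of `b`,
  -- so divisibility by `q` in `C[x]` descends to divisibility by `g` in `D`.
  have hdvd : ∀ (u : D) (n : ℕ) (U : C[X]), algebraMap C D b ^ n * u = aeval x U → q ∣ U →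
      g ∣ u := by
    rintro u n _ hU ⟨V, rfl⟩
    refine h.dvd_of_dvd_algebraMap_mul (pow_ne_zero n h.right_ne_zero)
      (fun p hp hpb => hg p hp (hp.dvd_of_dvd_pow hpb)) ?_
    rw [map_pow, hU, map_mul, hsg]
    exact ((dvd_mul_left g _).mul_right _)
  rintro u v ⟨r, hr⟩
  obtain ⟨i, U, hU⟩ := h.exists_right_pow_mul u
  obtain ⟨j, V, hV⟩ := h.exists_right_pow_mul v
  obtain ⟨k, W, hW⟩ := h.exists_right_pow_mul r
  have key : Polynomial.C (s * b ^ k) * (U * V) = q * (Polynomial.C b ^ (i + j) * W) := by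
    apply h.aeval_injective
    simp only [map_mul, map_pow, ← hU, ← hV, ← hW, aeval_C, hsg]
    linear_combination algebraMap C D s * algebraMap C D b ^ (k + i + j) * hr
  rcases hq.dvd_or_dvd ⟨_, key⟩ with ⟨Q, hQ⟩ | h1
  · refine absurd (hconst (s * b ^ k) ?_) (mul_ne_zero hs0 (pow_ne_zero _ h.right_ne_zero))
    rw [← aeval_C x, hQ, map_mul]
    exact P.mul_mem_right _ hqP
  · exact (hq.dvd_or_dvd h1).imp (hdvd u i U hU) (hdvd v j V hV)

end IsBezoutAdjunction

/-! ### Adjoining a Bézout relation inside a field -/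

theorem exists_pow_mul_eq_aeval_of_mem_adjoin_pair {C Ω : Type*} [CommRing C] [CommRing Ω]
    [Algebra C Ω] {a b : C} {x y : Ω}
    (hxy : algebraMap C Ω a * x + algebraMap C Ω b * y = 1) {f : Ω}
    (hf : f ∈ Algebra.adjoin C {x, y}) :
    ∃ (n : ℕ) (F : Polynomial C), algebraMap C Ω b ^ n * f = Polynomial.aeval x F := by
  induction hf using Algebra.adjoin_induction with
  | mem z hz =>
    rcases hz with rfl | rfl
    · exact ⟨0, Polynomial.X, by simp⟩
    · refine ⟨1, 1 - Polynomial.C a * Polynomial.X, ?_⟩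
      simp only [map_sub, map_mul, map_one, Polynomial.aeval_C, Polynomial.aeval_X]
      linear_combination hxy
  | algebraMap r => exact ⟨0, Polynomial.C r, by simp⟩
  | add f g _ _ hf hg =>
    obtain ⟨n, F, hF⟩ := hf
    obtain ⟨m, G, hG⟩ := hg
    refine ⟨n + m, Polynomial.C b ^ m * F + Polynomial.C b ^ n * G, ?_⟩
    simp only [map_add, map_mul, map_pow, Polynomial.aeval_C, ← hF, ← hG]
    ring
  | mul f g _ _ hf hg =>
    obtain ⟨n, F, hF⟩ := hf
    obtain ⟨m, G, hG⟩ := hg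
    refine ⟨n + m, F * G, ?_⟩
    rw [map_mul, ← hF, ← hG]
    ring

theorem isBezoutAdjunction_adjoin {C Ω : Type*} [CommRing C] [IsDomain C] [Field Ω]
    [Algebra C Ω] [FaithfulSMul C Ω] {a b : C} (ha : a ≠ 0) (hb : b ≠ 0) (hab : IsRelPrime a b)
    {x y : Ω} (hx : Transcendental C x)
    (hxy : algebraMap C Ω a * x + algebraMap C Ω b * y = 1) :
    IsBezoutAdjunction a b (D := Algebra.adjoin C {x, y})
      ⟨x, Algebra.subset_adjoin (by simp)⟩ ⟨y, Algebra.subset_adjoin (by simp)⟩ where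
  left_ne_zero := ha
  right_ne_zero := hb
  isRelPrime := hab
  bezout := Subtype.ext hxy
  transcendental_left h := hx (h.algHom (Subalgebra.val _))
  transcendental_right h := by
    have hy : IsAlgebraic C y := h.algHom (Subalgebra.val _)
    have ha' : algebraMap C Ω a ≠ 0 :=
      (map_ne_zero_iff _ (FaithfulSMul.algebraMap_injective C Ω)).2 ha
    have hx' : x = (algebraMap C Ω a)⁻¹ * (1 - algebraMap C Ω b * y) := by
      rw [← hxy]
      field_simp
      ring
    apply hx
    rw [hx']
    exact (isAlgebraic_algebraMap a).inv.mul
      (isAlgebraic_one.sub ((isAlgebraic_algebraMap b).mul hy))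
  exists_left_pow_mul f := by
    have hf : (f : Ω) ∈ Algebra.adjoin C {y, x} := by
      rw [Set.pair_comm]
      exact f.2
    obtain ⟨n, F, hF⟩ := exists_pow_mul_eq_aeval_of_mem_adjoin_pair
      (show algebraMap C Ω b * y + algebraMap C Ω a * x = 1 by rw [add_comm]; exact hxy) hf
    exact ⟨n, F, Subtype.ext (by rw [Polynomial.aeval_subalgebra_coe]; exact hF)⟩
  exists_right_pow_mul f := by
    obtain ⟨n, F, hF⟩ := exists_pow_mul_eq_aeval_of_mem_adjoin_pair hxy f.2
    exact ⟨n, F, Subtype.ext (by rw [Polynomial.aeval_subalgebra_coe]; exact hF)⟩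

/-! ### Factorially closed extensions and directed unions -/

/-- `C.FactoriallyClosedIn D` says that `C ≤ D` and that `C` contains every factor in `D` of a
nonzero element of `C`. Only the first factor is mentioned, the other one follows by commutativity.
This relative form compares two subalgebras of a common algebra. -/
def Subalgebra.FactoriallyClosedIn {A Ω : Type*} [CommRing A] [CommRing Ω] [Algebra A Ω]
    (C D : Subalgebra A Ω) : Prop :=
  C ≤ D ∧ ∀ f ∈ D, ∀ g ∈ D, f ≠ 0 → g ≠ 0 → f * g ∈ C → f ∈ C

namespace Subalgebra

section

variable {A Ω : Type*} [CommRing A] [CommRing Ω] [Algebra A Ω] {C D E : Subalgebra A Ω}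

theorem FactoriallyClosedIn.refl (C : Subalgebra A Ω) : C.FactoriallyClosedIn C :=
  ⟨le_rfl, fun _ hf _ _ _ _ _ => hf⟩

theorem FactoriallyClosedIn.trans (h₁ : C.FactoriallyClosedIn D) (h₂ : D.FactoriallyClosedIn E) :
    C.FactoriallyClosedIn E :=
  ⟨h₁.1.trans h₂.1, fun f hf g hg hf0 hg0 hfg => h₁.2 f (h₂.2 f hf g hg hf0 hg0 (h₁.1 hfg))
    g (h₂.2 g hg f hf hg0 hf0 (h₁.1 (mul_comm f g ▸ hfg))) hf0 hg0 hfg⟩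

theorem FactoriallyClosedIn.isUnit [Nontrivial Ω] (h : C.FactoriallyClosedIn D) {u : C}
    (hu : IsUnit (Subalgebra.inclusion h.1 u)) : IsUnit u := by
  obtain ⟨v, hv⟩ := isUnit_iff_exists_inv.1 hu
  have huv : (u : Ω) * v = 1 := congrArg Subtype.val hv
  have hv0 : (v : Ω) ≠ 0 := right_ne_zero_of_mul_eq_one huv
  have hvC : (v : Ω) ∈ C := h.2 v v.2 u (h.1 u.2) hv0 (left_ne_zero_of_mul_eq_one huv)
    (by rw [mul_comm, huv]; exact C.one_mem)
  exact isUnit_iff_exists_inv.2 ⟨⟨v, hvC⟩, Subtype.ext huv⟩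

/-- A prime of `C` stays irreducible in `D`, hence prime if `D` is a UFD. -/
theorem FactoriallyClosedIn.prime [IsDomain Ω] [UniqueFactorizationMonoid D]
    (h : C.FactoriallyClosedIn D) {p : C} (hp : Prime p) : Prime (Subalgebra.inclusion h.1 p) := by
  refine Irreducible.prime ⟨fun hu => hp.not_isUnit (h.isUnit hu), fun u v huv => ?_⟩
  have huv' : (p : Ω) = u * v := congrArg Subtype.val huv
  have hp0 : (p : Ω) ≠ 0 := by simpa using hp.ne_zero
  have hu0 : (u : Ω) ≠ 0 := left_ne_zero_of_mul (huv' ▸ hp0)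
  have hv0 : (v : Ω) ≠ 0 := right_ne_zero_of_mul (huv' ▸ hp0)
  have hu : (u : Ω) ∈ C := h.2 u u.2 v v.2 hu0 hv0 (huv' ▸ p.2)
  have hv : (v : Ω) ∈ C := h.2 v v.2 u u.2 hv0 hu0 (by rw [mul_comm, ← huv']; exact p.2)
  exact (hp.irreducible.isUnit_or_isUnit (a := ⟨u, hu⟩) (b := ⟨v, hv⟩) (Subtype.ext huv')).imp
    (fun h' => h'.map (Subalgebra.inclusion h.1)) (fun h' => h'.map (Subalgebra.inclusion h.1))

section Directed

variable {ι : Type*} [Nonempty ι] {K : ι → Subalgebra A Ω}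

theorem mem_iSup_of_directed_factoriallyClosedIn (hK : Directed FactoriallyClosedIn K) {z : Ω} :
    z ∈ iSup K ↔ ∃ i, z ∈ K i := by
  rw [← SetLike.mem_coe, coe_iSup_of_directed (hK.mono fun _ _ h => h.1), Set.mem_iUnion]
  rfl

theorem factoriallyClosedIn_iSup_of_directed (hK : Directed FactoriallyClosedIn K) (i : ι) :
    (K i).FactoriallyClosedIn (iSup K) := by
  refine ⟨le_iSup K i, fun f hf g hg hf0 hg0 hfg => ?_⟩
  obtain ⟨j, hj⟩ := (mem_iSup_of_directed_factoriallyClosedIn hK).1 hf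
  obtain ⟨k, hk⟩ := (mem_iSup_of_directed_factoriallyClosedIn hK).1 hg
  obtain ⟨l, hil, hjl⟩ := hK i j
  obtain ⟨m, hlm, hkm⟩ := hK l k
  exact (hil.trans hlm).2 f (hlm.1 (hjl.1 hj)) g (hkm.1 hk) hf0 hg0 hfg

theorem prime_inclusion_iSup_of_directed [IsDomain Ω] (hK : Directed FactoriallyClosedIn K)
    (hufd : ∀ i, UniqueFactorizationMonoid (K i)) {i : ι} {p : K i} (hp : Prime p) :
    Prime (Subalgebra.inclusion (le_iSup K i) p) := by
  refine ⟨?_, fun hu => hp.not_isUnit ((factoriallyClosedIn_iSup_of_directed hK i).isUnit hu), ?_⟩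
  · rw [Ne, ← ZeroMemClass.coe_eq_zero]
    simpa using hp.ne_zero
  · rintro ⟨u, hu⟩ ⟨v, hv⟩ ⟨⟨w, hw⟩, h⟩
    have h' : u * v = p * w := congrArg Subtype.val h
    obtain ⟨j, hj⟩ := (mem_iSup_of_directed_factoriallyClosedIn hK).1 hu
    obtain ⟨k, hk⟩ := (mem_iSup_of_directed_factoriallyClosedIn hK).1 hv
    obtain ⟨l, hl⟩ := (mem_iSup_of_directed_factoriallyClosedIn hK).1 hw
    obtain ⟨m, him, hjm⟩ := hK i j
    obtain ⟨n, hkn, hln⟩ := hK k l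
    obtain ⟨o, hmo, hno⟩ := hK m n
    have := hufd o
    have hpo := (him.trans hmo).prime hp
    have hdvd : Subalgebra.inclusion (him.trans hmo).1 p ∣
        (⟨u, (hjm.trans hmo).1 hj⟩ : K o) * ⟨v, (hkn.trans hno).1 hk⟩ :=
      ⟨⟨w, (hln.trans hno).1 hl⟩, Subtype.ext h'⟩
    exact (hpo.dvd_or_dvd hdvd).imp (map_dvd (Subalgebra.inclusion (le_iSup K o)))
      (map_dvd (Subalgebra.inclusion (le_iSup K o)))

theorem uniqueFactorizationMonoid_iSup_of_directed [IsDomain Ω]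
    (hK : Directed FactoriallyClosedIn K) (hufd : ∀ i, UniqueFactorizationMonoid (K i)) :
    UniqueFactorizationMonoid (iSup K : Subalgebra A Ω) := by
  refine UniqueFactorizationMonoid.of_exists_prime_factors fun z hz => ?_
  obtain ⟨i, hi⟩ := (mem_iSup_of_directed_factoriallyClosedIn hK).1 z.2
  have := hufd i
  have hz' : (⟨z, hi⟩ : K i) ≠ 0 := fun h =>
    hz (Subtype.ext (show (z : Ω) = 0 from congrArg Subtype.val h))
  obtain ⟨s, hs, hsz⟩ := UniqueFactorizationMonoid.exists_prime_factors _ hz'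
  refine ⟨s.map (Subalgebra.inclusion (le_iSup K i)), fun q hq => ?_, ?_⟩
  · obtain ⟨p, hp, rfl⟩ := Multiset.mem_map.1 hq
    exact prime_inclusion_iSup_of_directed hK hufd (hs p hp)
  · rw [← map_multiset_prod]
    exact hsz.map (Subalgebra.inclusion (le_iSup K i))

end Directed

end

end Subalgebra

/-! ### Zorn's lemma -/

open Cardinal in
/-- A set of variables large enough to index all pairs of rational functions in these variables:
`T = A × ℕ` is infinite and has at least the cardinality of `A`. -/
theorem exists_surjective_fractionRing_mvPolynomial_prod (A : Type u) [CommRing A] [Nontrivial A] :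
    ∃ (T : Type u) (e : T → FractionRing (MvPolynomial T A) × FractionRing (MvPolynomial T A)),
      Function.Surjective e := by
  refine ⟨A × ℕ, ?_⟩
  have hA : #A ≤ #(A × ℕ) :=
    mk_le_of_injective (f := fun a => (a, 0)) fun _ _ h => (Prod.ext_iff.1 h).1
  have hT : ℵ₀ ≤ #(A × ℕ) := aleph0_le_mk _
  have h : #(FractionRing (MvPolynomial (A × ℕ) A)) = #(A × ℕ) := by
    rw [FractionRing.cardinalMk, MvPolynomial.cardinalMk_eq_max, max_eq_right hA, max_eq_left hT]
  have h2 : #(A × ℕ) = #(FractionRing (MvPolynomial (A × ℕ) A) ×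
      FractionRing (MvPolynomial (A × ℕ) A)) := by
    rw [← mul_def, h, mul_eq_self hT]
  obtain ⟨e⟩ := Cardinal.eq.1 h2
  exact ⟨e, e.surjective⟩

theorem isAlgebraic_adjoin_mono {A Ω : Type*} [CommRing A] [CommRing Ω] [Algebra A Ω]
    {s t : Set Ω} (hst : s ⊆ t) {z : Ω}
    (hz : IsAlgebraic (Algebra.adjoin A s) z) : IsAlgebraic (Algebra.adjoin A t) z :=
  hz.tower_top_of_subalgebra_le (Algebra.adjoin_mono hst)

theorem isAlgebraic_of_mem_adjoin {A Ω : Type*} [CommRing A] [CommRing Ω] [IsDomain Ω]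
    [Algebra A Ω] {S C : Subalgebra A Ω}
    (hC : ∀ c ∈ C, IsAlgebraic S c) {s : Set Ω} (hs : ∀ z ∈ s, IsAlgebraic S z) {z : Ω}
    (hz : z ∈ Algebra.adjoin C s) : IsAlgebraic S z := by
  induction hz using Algebra.adjoin_induction with
  | mem z hz => exact hs z hz
  | algebraMap c => exact hC c c.2
  | add _ _ _ _ hf hg => exact hf.add hg
  | mul _ _ _ _ hf hg => exact hf.mul hg

/-- An intermediate stage `(C, J)` of the construction in `Ω`. The variable `X t` is reserved for
making the two components of `e t` comaximal, and `J` is the set of variables already spent: `C` is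
a UFD in which the base ring is factorially closed, it is algebraic over the subalgebra generated by
the spent variables, and it contains Bézout coefficients for `e t` whenever `t ∈ J`. The components
of `e t` need not lie in `C`. -/
structure IsBezoutStage {A Ω T : Type*} [CommRing A] [CommRing Ω] [Algebra A Ω]
    (X : T → Ω) (e : T → Ω × Ω) (C : Subalgebra A Ω) (J : Set T) : Prop where
  uniqueFactorizationMonoid : UniqueFactorizationMonoid C
  bot_factoriallyClosedIn : (⊥ : Subalgebra A Ω).FactoriallyClosedIn C
  isAlgebraic : ∀ z ∈ C, IsAlgebraic (Algebra.adjoin A (X '' J)) z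
  bezout : ∀ t ∈ J, ∃ x ∈ C, ∃ y ∈ C, (e t).1 * x + (e t).2 * y = 1

namespace IsBezoutStage

variable {A Ω T : Type*} [CommRing A]

theorem bot [IsDomain A] [UniqueFactorizationMonoid A] [CommRing Ω] [IsDomain Ω] [Algebra A Ω]
    [FaithfulSMul A Ω] (X : T → Ω) (e : T → Ω × Ω) :
    IsBezoutStage X e (⊥ : Subalgebra A Ω) ∅ where
  uniqueFactorizationMonoid :=
    (Algebra.botEquivOfInjective (FaithfulSMul.algebraMap_injective A Ω)).symm.toMulEquiv
      |>.uniqueFactorizationMonoid inferInstance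
  bot_factoriallyClosedIn := .refl _
  isAlgebraic z hz := isAlgebraic_algebraMap
    (⟨z, bot_le (α := Subalgebra A Ω) hz⟩ : Algebra.adjoin A (X '' ∅))
  bezout _ ht := ht.elim

theorem iSup_of_directed [CommRing Ω] [IsDomain Ω] [Algebra A Ω] {X : T → Ω} {e : T → Ω × Ω}
    {ι : Type*} [Nonempty ι] {K : ι → Subalgebra A Ω} {J : ι → Set T}
    (hK : Directed Subalgebra.FactoriallyClosedIn K)
    (hst : ∀ i, IsBezoutStage X e (K i) (J i)) :
    IsBezoutStage X e (iSup K) (⋃ i, J i) where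
  uniqueFactorizationMonoid := Subalgebra.uniqueFactorizationMonoid_iSup_of_directed hK
    fun i => (hst i).uniqueFactorizationMonoid
  bot_factoriallyClosedIn := (hst (Classical.arbitrary ι)).bot_factoriallyClosedIn.trans
    (Subalgebra.factoriallyClosedIn_iSup_of_directed hK _)
  isAlgebraic z hz := by
    obtain ⟨i, hi⟩ := (Subalgebra.mem_iSup_of_directed_factoriallyClosedIn hK).1 hz
    exact isAlgebraic_adjoin_mono (Set.image_mono (Set.subset_iUnion J i))
      ((hst i).isAlgebraic z hi)
  bezout t ht := by
    obtain ⟨i, hi⟩ := Set.mem_iUnion.1 ht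
    obtain ⟨x, hx, y, hy, hxy⟩ := (hst i).bezout t hi
    exact ⟨x, le_iSup K i hx, y, le_iSup K i hy, hxy⟩

/-- One step of the construction: if the variable reserved for the relatively prime elements `a`
and `b` is not spent, it is transcendental over `C`, and `x = X t`, `y = (1 - a * x) / b` can be
adjoined. -/
theorem exists_insert [Field Ω] [Algebra A Ω] [IsDomain A] {X : T → Ω} {e : T → Ω × Ω}
    {C : Subalgebra A Ω} {J : Set T} (hX : AlgebraicIndependent A X) (h : IsBezoutStage X e C J)
    {t : T} (ht : t ∉ J) {a b : C} (he : e t = ((a : Ω), (b : Ω))) (ha : a ≠ 0) (hb : b ≠ 0)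
    (hab : IsRelPrime a b) :
    ∃ D : Subalgebra A Ω, C.FactoriallyClosedIn D ∧ IsBezoutStage X e D (insert t J) := by
  have := h.uniqueFactorizationMonoid
  have hX' : Transcendental (Subalgebra.algebraicClosure (Algebra.adjoin A (X '' J)) Ω) (X t) :=
    (hX.transcendental_adjoin ht).subalgebraAlgebraicClosure
  have hx : Transcendental C (X t) := Transcendental.of_tower_top_of_subalgebra_le
    (B := (Subalgebra.algebraicClosure (Algebra.adjoin A (X '' J)) Ω).restrictScalars A)
    h.isAlgebraic hX'
  have hb0 : (b : Ω) ≠ 0 := by simpa using hb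
  obtain ⟨y, hy⟩ : ∃ y : Ω, y = (b : Ω)⁻¹ * (1 - a * X t) := ⟨_, rfl⟩
  have hxy : (a : Ω) * X t + b * y = 1 := by
    rw [hy, mul_inv_cancel_left₀ hb0]
    ring
  have hadj := isBezoutAdjunction_adjoin ha hb hab hx hxy
  have hC : ∀ c : C, (c : Ω) ∈ Algebra.adjoin C {X t, y} := fun c =>
    (Algebra.adjoin C {X t, y}).algebraMap_mem c
  have hxD : X t ∈ Algebra.adjoin C {X t, y} := Algebra.subset_adjoin (Set.mem_insert _ _)
  have hyD : y ∈ Algebra.adjoin C {X t, y} := Algebra.subset_adjoin (Set.mem_insert_of_mem _ rfl)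
  have hCD : C.FactoriallyClosedIn ((Algebra.adjoin C {X t, y}).restrictScalars A) := by
    refine ⟨fun c hc => hC ⟨c, hc⟩, fun f hf g hg hf0 hg0 hfg => ?_⟩
    obtain ⟨d, hd⟩ := hadj.exists_algebraMap_eq_of_mul_eq (f := ⟨f, hf⟩) (g := ⟨g, hg⟩)
      (c := ⟨f * g, hfg⟩) (fun h0 => mul_ne_zero hf0 hg0 (congrArg Subtype.val h0)) rfl
    rw [← show (d : Ω) = f from congrArg Subtype.val hd]
    exact d.2
  refine ⟨_, hCD, hadj.uniqueFactorizationMonoid, h.bot_factoriallyClosedIn.trans hCD, ?_, ?_⟩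
  · have hCalg : ∀ c ∈ C, IsAlgebraic (Algebra.adjoin A (X '' insert t J)) c := fun c hc =>
      isAlgebraic_adjoin_mono (Set.image_mono (Set.subset_insert t J)) (h.isAlgebraic c hc)
    have hxalg : IsAlgebraic (Algebra.adjoin A (X '' insert t J)) (X t) := isAlgebraic_algebraMap
      (⟨X t, Algebra.subset_adjoin (Set.mem_image_of_mem X (Set.mem_insert t J))⟩ :
        Algebra.adjoin A (X '' insert t J))
    refine fun z hz => isAlgebraic_of_mem_adjoin hCalg ?_ hz
    rintro z (rfl | rfl)
    · exact hxalg
    · rw [hy]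
      exact (hCalg b b.2).inv.mul (isAlgebraic_one.sub ((hCalg a a.2).mul hxalg))
  · rintro s (rfl | hs)
    · rw [he]
      exact ⟨X s, hxD, y, hyD, hxy⟩
    · obtain ⟨u, hu, v, hv, huv⟩ := h.bezout s hs
      exact ⟨u, hCD.1 hu, v, hCD.1 hv, huv⟩

/-- A maximal stage has the required property: a relatively prime pair whose variable is not spent
would allow a strictly larger stage. -/
theorem exists_forall_isRelPrime_isCoprime [IsDomain A] [UniqueFactorizationMonoid A] [Field Ω]
    [Algebra A Ω] {X : T → Ω} {e : T → Ω × Ω} (hX : AlgebraicIndependent A X)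
    (he : Function.Surjective e) :
    ∃ C : Subalgebra A Ω, UniqueFactorizationMonoid C ∧
      (⊥ : Subalgebra A Ω).FactoriallyClosedIn C ∧
      ∀ a b : C, IsRelPrime a b → IsCoprime a b := by
  have : FaithfulSMul A Ω := (faithfulSMul_iff_algebraMap_injective A Ω).2 hX.algebraMap_injective
  let r : {p : Subalgebra A Ω × Set T // IsBezoutStage X e p.1 p.2} →
      {p : Subalgebra A Ω × Set T // IsBezoutStage X e p.1 p.2} → Prop :=
    fun p q => p.1.1.FactoriallyClosedIn q.1.1 ∧ p.1.2 ⊆ q.1.2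
  have hrefl : Std.Refl r := ⟨fun p => ⟨.refl _, subset_rfl⟩⟩
  obtain ⟨⟨⟨C, J⟩, hC⟩, hmax⟩ : ∃ m, ∀ p, r m p → r p m := by
    refine exists_maximal_of_chains_bounded (fun c hc => ?_)
      fun h₁ h₂ => ⟨h₁.1.trans h₂.1, h₁.2.trans h₂.2⟩
    rcases c.eq_empty_or_nonempty with rfl | hne
    · exact ⟨⟨(⊥, ∅), bot X e⟩, fun _ h => h.elim⟩
    have := hne.to_subtype
    have hdir : Directed Subalgebra.FactoriallyClosedIn fun p : c => p.1.1.1 :=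
      fun p q => (hc.total p.2 q.2).elim
        (fun h => ⟨q, h.1, .refl _⟩) fun h => ⟨p, .refl _, h.1⟩
    exact ⟨⟨(_, _), iSup_of_directed hdir (J := fun p : c => p.1.1.2) fun p => p.1.2⟩,
      fun p hp => ⟨Subalgebra.factoriallyClosedIn_iSup_of_directed hdir ⟨p, hp⟩,
        Set.subset_iUnion (fun p : c => p.1.1.2) ⟨p, hp⟩⟩⟩
  refine ⟨C, hC.uniqueFactorizationMonoid, hC.bot_factoriallyClosedIn, fun a b hab => ?_⟩
  by_cases ha : a = 0
  · subst ha
    exact isCoprime_zero_left.2 (isRelPrime_zero_left.1 hab)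
  by_cases hb : b = 0
  · subst hb
    exact isCoprime_zero_right.2 (isRelPrime_zero_right.1 hab)
  obtain ⟨t, ht⟩ := he ((a : Ω), (b : Ω))
  have htJ : t ∈ J := by
    by_contra htJ
    obtain ⟨D, hCD, hD⟩ := hC.exists_insert hX htJ ht ha hb hab
    exact htJ ((hmax ⟨(D, insert t J), hD⟩ ⟨hCD, Set.subset_insert t J⟩).2 (Set.mem_insert t J))
  obtain ⟨x, hx, y, hy, hxy⟩ := hC.bezout t htJ
  rw [ht] at hxy
  exact ⟨⟨x, hx⟩, ⟨y, hy⟩, Subtype.ext (by simpa [mul_comm] using hxy)⟩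

end IsBezoutStage

/-! ### Existence of the principal ideal domain -/

theorem isPrincipalIdealRing_of_forall_isRelPrime_isCoprime {B : Type*} [CommRing B] [IsDomain B]
    [UniqueFactorizationMonoid B] (h : ∀ a b : B, IsRelPrime a b → IsCoprime a b) :
    IsPrincipalIdealRing B := by
  have : IsBezout B := by
    refine IsBezout.iff_span_pair_isPrincipal.2 fun a b => ?_
    by_cases ha : a = 0
    · subst ha
      exact ⟨b, by simp⟩
    obtain ⟨a', b', c, hab, rfl, rfl⟩ := UniqueFactorizationMonoid.exists_reduced_factors a ha b
    obtain ⟨r, s, hrs⟩ := h a' b' hab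
    refine ⟨c, le_antisymm ?_ ?_⟩
    · rw [Ideal.span_le, Set.pair_subset_iff]
      exact ⟨Ideal.mem_span_singleton.2 (dvd_mul_right _ _),
        Ideal.mem_span_singleton.2 (dvd_mul_right _ _)⟩
    · rw [Ideal.submodule_span_eq, Ideal.span_singleton_le_iff_mem, Ideal.mem_span_pair]
      exact ⟨r, s, by linear_combination c * hrs⟩
  exact ((IsBezout.TFAE (R := B)).out 2 1 :
    UniqueFactorizationMonoid B ↔ IsPrincipalIdealRing B).1 inferInstance

theorem mainTheorem12 (R : Type v) [CommRing R] (A : Type u) [CommRing A] [IsDomain A]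
    [UniqueFactorizationMonoid A] [Algebra R A] :
    ∃ (B : Type u) (_ : CommRing B) (_ : IsDomain B) (_ : IsPrincipalIdealRing B)
      (_ : Algebra R B) (φ : A →ₐ[R] B),
      Function.Injective φ ∧ φ.range.IsFactoriallyClosed := by
  obtain ⟨T, e, he⟩ := exists_surjective_fractionRing_mvPolynomial_prod A
  let Ω := FractionRing (MvPolynomial T A)
  let X : T → Ω := fun t => algebraMap _ _ (MvPolynomial.X (R := A) t)
  have hX : AlgebraicIndependent A X :=
    (MvPolynomial.algebraicIndependent_X T A).map' (f := IsScalarTower.toAlgHom A _ Ω)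
      (IsFractionRing.injective _ _)
  obtain ⟨B, hB, hAB, hcop⟩ := IsBezoutStage.exists_forall_isRelPrime_isCoprime hX he
  refine ⟨B, inferInstance, inferInstance,
    isPrincipalIdealRing_of_forall_isRelPrime_isCoprime hcop,
    ((algebraMap A B).comp (algebraMap R A)).toAlgebra,
    letI := ((algebraMap A B).comp (algebraMap R A)).toAlgebra
    ⟨algebraMap A B, fun _ => rfl⟩, ?_, ?_⟩
  · exact FaithfulSMul.algebraMap_injective A B
  · have key : ∀ f g : B, f ≠ 0 → g ≠ 0 → (∃ c, algebraMap A B c = f * g) →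
        ∃ c, algebraMap A B c = f := by
      rintro f g hf hg ⟨c, hc⟩
      obtain ⟨d, hd⟩ := Algebra.mem_bot.1 (hAB.2 f f.2 g g.2 (by simpa using hf) (by simpa using hg)
        (Algebra.mem_bot.2 ⟨c, congrArg Subtype.val hc⟩))
      exact ⟨d, Subtype.ext hd⟩
    exact fun f g hf hg hfg => ⟨key f g hf hg hfg, key g f hg hf (by rw [mul_comm]; exact hfg)⟩
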